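/- For a finite-dimensional real vector space $V$ let $V^{r,s}=V^{\otimes r}\otimes (V^*)^{\otimes s}$ and $T_V=\bigoplus_{r,s\ge 0}V^{r,s}$. A linear isomorphism $\alpha:V\to W$ induces isomorphisms $\rho(\alpha):V^{r,s}\to W^{r,s}$ and $\rho(\alpha):T_V\to T_W$ (acting by $\alpha$ on vectors and by $\omega\mapsto\omega\circ\alpha^{-1}$ on covectors). For $w\in T_V\setminus\{0\}$ let $[w]$ denote its class in the projective space $\mathbb P T_V$, and put $\rho(\alpha)[w]=[\rho(\alpha)w]$. Let $M$ be a smooth $n$-dimensional manifold (Hausdorff, second countable). A linear frame at $x\in M$ is a linear isomorphism $z:\mathbb R^n\to T_xM$. For a closed subgroup $H\subset GL(n,\mathbb R)$, an $H$-structure on $M$ is a smooth reduction $P$ of the linear frame bundle of $M$ to $H$. A tensor field $\tau$ of type $(r,s)$ on $M$ is called $0$-deformable if for all $x,y\in M$ there is a linear isomorphism $\alpha:T_xM\to T_yM$ with $\rho(\alpha)(\tau(x))=\tau(y)$. **Theorem.** Let $G$ be an algebraic subgroup of $GL(n,\mathbb R)$, i.e. a subgroup which is the set of common zeros in $GL(n,\mathbb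 R)$ of a family of real polynomials in the matrix entries, and let $\mathcal N(G)=\{g\in GL(n,\mathbb R)\mid g^{-1}Gg=G\}$ be its normalizer. Then every $\mathcal N(G)$-structure is given by the projectivization of an inhomogeneous tensor field which is a finite sum of $0$-deformable tensor fields. Precisely, there are finitely many pairwise distinct types $(r_1,s_1),\dots,(r_m,s_m)$ and a nonzero inhomogeneous tensor $u=\sum_{i=1}^m u_i$, $u_i\in(\mathbb R^n)^{r_i,s_i}$, depending only on $G$, such that $$\mathcal N(G)=\{g\in GL(n,\mathbb R)\mid \rho(g)[u]=[u]\},$$ and for every smooth $n$-dimensional manifold $M$ and every $\mathcal N(G)$-structure $P$ on $M$ there are smooth $0$-deformable tensor fields $t_i$ of type $(r_i,s_i)$ on $M$ $(1\le i\le m)$ such that the inhomogeneous tensor field $t=\sum_{i=1}^m t_i$ vanishes nowhere and, for every $x\in M$ and every linear frame $z$ at $x$, $$z\in P\iff \rho(z)[u]=[t(x)].$$ -/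

import Mathlib

open scoped Manifold ContDiff TensorProduct DirectSum

noncomputable section

/-! ### Tensors over a real vector space -/

section Tensors

variable {V W : Type*} [AddCommGroup V] [Module ℝ V] [AddCommGroup W] [Module ℝ W]

/-- The space `V^{r,s} = V^{⊗ r} ⊗ (V^*)^{⊗ s}` of tensors of type `(r, s)` over `V`. -/
abbrev TensorOfType (r s : ℕ) (V : Type*) [AddCommGroup V] [Module ℝ V] : Type _ :=
  (⨂[ℝ]^r V) ⊗[ℝ] (⨂[ℝ]^s (Module.Dual ℝ V))

/-- The isomorphism `V^{r,s} ≃ W^{r,s}` induced by a linear isomorphism `α : V ≃ W`: vectors are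
transformed by `v ↦ α v`, covectors by `ω ↦ ω ∘ α⁻¹`. -/
def tensorMap (r s : ℕ) (α : V ≃ₗ[ℝ] W) : TensorOfType r s V ≃ₗ[ℝ] TensorOfType r s W :=
  TensorProduct.congr (PiTensorProduct.congr fun _ : Fin r => α)
    (PiTensorProduct.congr fun _ : Fin s => α.symm.dualMap)

/-- The whole (mixed) tensor space `T_V = ⨁_{r,s ≥ 0} V^{r,s}`; its elements are the
inhomogeneous tensors over `V`. -/
abbrev MixedTensor (V : Type*) [AddCommGroup V] [Module ℝ V] : Type _ :=
  ⨁ p : ℕ × ℕ, TensorOfType p.1 p.2 V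

/-- The isomorphism `T_V ≃ T_W` induced by a linear isomorphism `α : V ≃ W`. For `W = V` this is
the tensorial representation `ρ` of `GL(V)`. -/
def mixedTensorMap (α : V ≃ₗ[ℝ] W) : MixedTensor V ≃ₗ[ℝ] MixedTensor W :=
  DFinsupp.mapRange.linearEquiv fun p : ℕ × ℕ => tensorMap p.1 p.2 α

/-- The map `ℙ T_V → ℙ T_W` between projective spaces induced by `α : V ≃ W`. -/
def projTensorMap (α : V ≃ₗ[ℝ] W) :
    Projectivization ℝ (MixedTensor V) → Projectivization ℝ (MixedTensor W) :=
  Projectivization.map (mixedTensorMap α).toLinearMap (mixedTensorMap α).injective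

/-- The inhomogeneous tensor `∑ i, τ i`, where `τ i` has type `(r i, s i)`. -/
def tensorSum {m : ℕ} {r s : Fin m → ℕ} (τ : ∀ i, TensorOfType (r i) (s i) V) : MixedTensor V :=
  ∑ i, DirectSum.lof ℝ (ℕ × ℕ) (fun p : ℕ × ℕ => TensorOfType p.1 p.2 V) (r i, s i) (τ i)

end Tensors

/-! ### Algebraic subgroups of `GL(n, ℝ)` -/

/-- A subgroup of `GL(n, ℝ)` is algebraic if it is the set of common zeros in `GL(n, ℝ)` of a
family of real polynomials in the matrix entries. (Allowing `1 / det` in addition gives the same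
subgroups, since one can clear denominators.) -/
def IsAlgebraicSubgroup {n : ℕ} (G : Subgroup (GL (Fin n) ℝ)) : Prop :=
  ∃ S : Set (MvPolynomial (Fin n × Fin n) ℝ),
    ∀ g : GL (Fin n) ℝ,
      g ∈ G ↔ ∀ p ∈ S, MvPolynomial.eval (fun ij => (g : Matrix (Fin n) (Fin n) ℝ) ij.1 ij.2) p = 0

/-- The linear automorphism `v ↦ g v` of `ℝⁿ` given by an invertible matrix. -/
def glEquiv {n : ℕ} (g : GL (Fin n) ℝ) : (Fin n → ℝ) ≃ₗ[ℝ] (Fin n → ℝ) :=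
  LinearMap.GeneralLinearGroup.generalLinearEquiv ℝ (Fin n → ℝ)
    (Matrix.GeneralLinearGroup.toLin g)

theorem glEquiv_apply {n : ℕ} (g : GL (Fin n) ℝ) (v : Fin n → ℝ) :
    glEquiv g v = (g : Matrix (Fin n) (Fin n) ℝ).mulVec v := rfl

/-! ### Frames, structures and tensor fields on a manifold -/

section Manifold

variable {n : ℕ} {M : Type*} [TopologicalSpace M] [ChartedSpace (EuclideanSpace ℝ (Fin n)) M]

/-- A linear frame at `x`, that is, a linear isomorphism `ℝⁿ ≃ T_x M`. The group `GL(n, ℝ)` acts on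
frames from the right by `z · g = z ∘ g`. -/
abbrev LinearFrame (n : ℕ) {M : Type*} [TopologicalSpace M]
    [ChartedSpace (EuclideanSpace ℝ (Fin n)) M] (x : M) : Type _ :=
  (Fin n → ℝ) ≃ₗ[ℝ] TangentSpace (𝓡 n) x

/-- A choice of frames is a smooth local section over `U` of the frame bundle if the `n` vector
fields that form it are smooth on `U`. -/
def IsSmoothFrameOn [IsManifold (𝓡 n) ∞ M] (σ : ∀ x : M, LinearFrame n x) (U : Set M) : Prop :=
  ∀ j : Fin n, ContMDiffOn (𝓡 n) (𝓡 n).tangent ∞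
    (fun x => (⟨x, σ x (Pi.single j 1)⟩ : TangentBundle (𝓡 n) M)) U

/-- An `H`-structure on the `n`-dimensional manifold `M`, for a closed subgroup `H` of `GL(n, ℝ)`:
a reduction of the linear frame bundle to `H`, given by the frames at each point that belong to the
reduction. They form one `H`-orbit at each point, and the reduction has smooth local sections. -/
structure HStructure {n : ℕ} (H : Subgroup (GL (Fin n) ℝ)) (M : Type*) [TopologicalSpace M]
    [ChartedSpace (EuclideanSpace ℝ (Fin n)) M] [IsManifold (𝓡 n) ∞ M] where
  frames : ∀ x : M, Set (LinearFrame n x)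
  mem_iff : ∀ (x : M) (z w : LinearFrame n x), z ∈ frames x →
    (w ∈ frames x ↔ ∃ g ∈ H, w = (glEquiv g).trans z)
  exists_section : ∀ x : M, ∃ U : Set M, IsOpen U ∧ x ∈ U ∧
    ∃ σ : ∀ y : M, LinearFrame n y, IsSmoothFrameOn σ U ∧ ∀ y ∈ U, σ y ∈ frames y

/-- A field of tensors of type `(r, s)` is smooth if near each point its components with respect to
a smooth local frame are smooth functions. (The components of `t` in the frame `σ x` form the tensor
`(σ x)⁻¹ t(x)` over `ℝⁿ`; smoothness in that finite-dimensional space is tested by linear forms.) -/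
def IsSmoothTensorField [IsManifold (𝓡 n) ∞ M] {r s : ℕ}
    (t : ∀ x : M, TensorOfType r s (TangentSpace (𝓡 n) x)) : Prop :=
  ∀ x : M, ∃ U : Set M, IsOpen U ∧ x ∈ U ∧ ∃ σ : ∀ y : M, LinearFrame n y, IsSmoothFrameOn σ U ∧
    ∀ φ : TensorOfType r s (Fin n → ℝ) →ₗ[ℝ] ℝ,
      ContMDiffOn (𝓡 n) 𝓘(ℝ, ℝ) ∞ (fun y => φ ((tensorMap r s (σ y)).symm (t y))) U

/-- A field of tensors of type `(r, s)` is 0-deformable if for all `x, y` some linear isomorphism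
`T_x M ≃ T_y M` carries its value at `x` to its value at `y`. -/
def IsZeroDeformable {r s : ℕ} (t : ∀ x : M, TensorOfType r s (TangentSpace (𝓡 n) x)) : Prop :=
  ∀ x y : M, ∃ α : TangentSpace (𝓡 n) x ≃ₗ[ℝ] TangentSpace (𝓡 n) y,
    tensorMap r s α (t x) = t y

end Manifold

end

/-! This is Chevalley's construction of a subgroup as the stabilizer of a line, arranged so that the
character is positive and can be undone by scalar matrices.

By the Hilbert basis theorem `G` is cut out by polynomials of degree at most some `k`. Such a
polynomial is a linear functional of the vector `wordEval k A` of all products of `k` entries, each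
taken from `A` or from the identity. Let `X` be the span of these vectors over `G`, with a basis
coming from `A 1, …, A d` in `G`. Conjugation by `g` acts linearly on word vectors, and `g`
normalizes `G` exactly when it preserves `X`: the equations of `G` vanish on `X`, so no element of
`G` can leave `G` (`conj_mem_of_wordEval_mem_span`).

The space `X` is encoded by its Plücker coordinates, the `d × d` minors, up to a common factor.
Products of two minors still determine `X` (`mem_span_of_minor_mul_minor`) but change by the square
of that factor. For each pattern of `A`'s and identities these products are the components of a
tensor `wedgeTensor`. Padding by identity endomorphisms gives different patterns different types,
and a squared determinant form is multiplied in. Hence the normalizer acts on `u` by a positive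
character, while the scalar matrix `l` multiplies `u` by `l ^ (2 * n)`, so every positive factor is
attained if `n ≠ 0`.

On a manifold, frames of `P` at one point give values of `u` that differ by positive factors, so
local fields can be glued by a partition of unity without vanishing. The resulting values are
positive multiples of a transported `u`; scalar matrices absorb the multiples, which gives
0-deformability. -/

noncomputable section

/-! ### Coordinates of tensors over `ℝⁿ` -/

section Coordinates

variable {n : ℕ}

/-- The basis of `(ℝⁿ)^{r,s}` formed by the products of standard basis vectors and covectors. -/
def tensorBasis (n r s : ℕ) :
    Module.Basis ((Fin r → Fin n) × (Fin s → Fin n)) ℝ (TensorOfType r s (Fin n → ℝ)) :=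
  (Basis.piTensorProduct fun _ : Fin r => Pi.basisFun ℝ (Fin n)).tensorProduct
    (Basis.piTensorProduct fun _ : Fin s => (Pi.basisFun ℝ (Fin n)).dualBasis)

theorem glEquiv_symm_apply (g : GL (Fin n) ℝ) (v : Fin n → ℝ) :
    (glEquiv g).symm v = ((g⁻¹ : GL (Fin n) ℝ) : Matrix (Fin n) (Fin n) ℝ).mulVec v := by
  rw [LinearEquiv.symm_apply_eq, glEquiv_apply, Matrix.mulVec_mulVec, ← Units.val_mul]
  simp

/-- Covectors are transformed by the transpose of `g⁻¹`, hence the reversed indices in the second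
product. -/
theorem tensorBasis_repr_tensorMap_basis (r s : ℕ) (g : GL (Fin n) ℝ)
    (q p : (Fin r → Fin n) × (Fin s → Fin n)) :
    (tensorBasis n r s).repr (tensorMap r s (glEquiv g) (tensorBasis n r s p)) q =
      (∏ a, (g : Matrix (Fin n) (Fin n) ℝ) (q.1 a) (p.1 a)) *
        ∏ b, ((g⁻¹ : GL (Fin n) ℝ) : Matrix (Fin n) (Fin n) ℝ) (p.2 b) (q.2 b) := by
  obtain ⟨q₁, q₂⟩ := q
  rw [tensorBasis, Module.Basis.tensorProduct_apply', tensorMap, TensorProduct.congr_tmul,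
    Basis.piTensorProduct_apply, Basis.piTensorProduct_apply, PiTensorProduct.congr_tprod,
    PiTensorProduct.congr_tprod, Module.Basis.tensorProduct_repr_tmul_apply,
    Basis.piTensorProduct_repr_tprod_apply, Basis.piTensorProduct_repr_tprod_apply,
    smul_eq_mul, mul_comm]
  congr 1
  · refine Finset.prod_congr rfl fun a _ => ?_
    simp [glEquiv_apply]
  · refine Finset.prod_congr rfl fun b _ => ?_
    rw [Module.Basis.dualBasis_repr, LinearEquiv.dualMap_apply, glEquiv_symm_apply]
    simp

theorem basis_repr_map {ι X : Type*} [Fintype ι] [AddCommGroup X] [Module ℝ X]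
    (b : Module.Basis ι ℝ X) (f : X →ₗ[ℝ] X) (t : X) (q : ι) :
    b.repr (f t) q = ∑ p, b.repr (f (b p)) q * b.repr t p := by
  conv_lhs => rw [← b.sum_repr t]
  simp only [map_sum, map_smul, Finsupp.coe_finsetSum, Finset.sum_apply, Finsupp.coe_smul,
    Pi.smul_apply, smul_eq_mul]
  exact Finset.sum_congr rfl fun p _ => mul_comm _ _

theorem tensorBasis_repr_tensorMap (r s : ℕ) (g : GL (Fin n) ℝ)
    (t : TensorOfType r s (Fin n → ℝ)) (q : (Fin r → Fin n) × (Fin s → Fin n)) :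
    (tensorBasis n r s).repr (tensorMap r s (glEquiv g) t) q =
      ∑ p : (Fin r → Fin n) × (Fin s → Fin n),
        ((∏ a, (g : Matrix (Fin n) (Fin n) ℝ) (q.1 a) (p.1 a)) *
          ∏ b, ((g⁻¹ : GL (Fin n) ℝ) : Matrix (Fin n) (Fin n) ℝ) (p.2 b) (q.2 b)) *
        (tensorBasis n r s).repr t p := by
  have h := basis_repr_map (tensorBasis n r s) (tensorMap r s (glEquiv g)).toLinearMap t q
  simp only [LinearEquiv.coe_coe, tensorBasis_repr_tensorMap_basis] at h
  exact h

/-- The components of the determinant form. -/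
def signCoord (I : Fin n → Fin n) : ℝ :=
  ((1 : Matrix (Fin n) (Fin n) ℝ).submatrix I id).det

theorem signCoord_id : signCoord (id : Fin n → Fin n) = 1 := by
  simp [signCoord]

/-- Multilinear expansion, row by row, of the determinant of the matrix with rows `g (I a)`. -/
theorem sum_prod_mul_signCoord (g : Matrix (Fin n) (Fin n) ℝ) (I : Fin n → Fin n) :
    ∑ I' : Fin n → Fin n, (∏ a, g (I a) (I' a)) * signCoord I' = g.det * signCoord I := by
  have h := (Matrix.detRowAlternating (R := ℝ) (n := Fin n)).toMultilinearMap.map_sum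
    (fun (a : Fin n) (j : Fin n) => g (I a) j • (1 : Matrix (Fin n) (Fin n) ℝ) j)
  have h1 : (fun a : Fin n => ∑ j, g (I a) j • (1 : Matrix (Fin n) (Fin n) ℝ) j) =
      (1 : Matrix (Fin n) (Fin n) ℝ).submatrix I id * g := by
    ext a j
    simp [Matrix.mul_apply, Matrix.one_apply]
  rw [h1] at h
  change Matrix.det _ = _ at h
  rw [Matrix.det_mul, mul_comm] at h
  rw [signCoord, h]
  refine Finset.sum_congr rfl fun I' _ => ?_
  rw [MultilinearMap.map_smul_univ]
  rfl

theorem sum_prod_mul_prod_mul {κ : Type*} [Fintype κ] [DecidableEq κ]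
    (g h : Matrix (Fin n) (Fin n) ℝ) (B : κ → Matrix (Fin n) (Fin n) ℝ) (I J : κ → Fin n) :
    ∑ I' : κ → Fin n, ∑ J' : κ → Fin n,
      (∏ t, g (I t) (I' t)) * (∏ t, h (J' t) (J t)) * ∏ t, B t (I' t) (J' t) =
      ∏ t, (g * B t * h) (I t) (J t) := by
  have h1 : ∀ t, (g * B t * h) (I t) (J t) =
      ∑ i, ∑ j, g (I t) i * h j (J t) * B t i j := by
    intro t
    simp only [Matrix.mul_apply, Finset.sum_mul]
    rw [Finset.sum_comm]
    exact Finset.sum_congr rfl fun i _ => Finset.sum_congr rfl fun j _ => by ring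
  simp only [h1, Fintype.prod_sum, ← Finset.prod_mul_distrib]

variable (κ : Type) [Fintype κ]

/-- Indices of the vector slots of the tensors `slotTensor`. -/
abbrev UpperSlot (n : ℕ) (κ : Type) : Type := κ ⊕ (Fin n ⊕ Fin n)

variable {κ} in
/-- The components of the product of the endomorphisms `B t`, `t : κ`, and of the square of the
determinant form. -/
def slotCoord (B : κ → Matrix (Fin n) (Fin n) ℝ) (I : UpperSlot n κ → Fin n) (J : κ → Fin n) : ℝ :=
  signCoord (I ∘ Sum.inr ∘ Sum.inl) * signCoord (I ∘ Sum.inr ∘ Sum.inr) *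
    ∏ t, B t (I (Sum.inl t)) (J t)

variable {κ} in
theorem sum_slotCoord [DecidableEq κ] (g h : Matrix (Fin n) (Fin n) ℝ)
    (B : κ → Matrix (Fin n) (Fin n) ℝ) (I : UpperSlot n κ → Fin n) (J : κ → Fin n) :
    ∑ I' : UpperSlot n κ → Fin n, ∑ J' : κ → Fin n,
      ((∏ a, g (I a) (I' a)) * ∏ b, h (J' b) (J b)) * slotCoord B I' J' =
      g.det ^ 2 * slotCoord (fun t => g * B t * h) I J := by
  rw [← (Equiv.sumArrowEquivProdArrow κ (Fin n ⊕ Fin n) (Fin n)).symm.sum_comp,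
    Fintype.sum_prod_type]
  simp_rw [← (Equiv.sumArrowEquivProdArrow (Fin n) (Fin n) (Fin n)).symm.sum_comp,
    Fintype.sum_prod_type]
  rw [slotCoord, ← sum_prod_mul_prod_mul]
  -- The endomorphism slots and the two determinant slots do not interact, so the sum is a product
  -- of three sums.
  trans (∑ I₁ : κ → Fin n, ∑ J' : κ → Fin n,
      (∏ t, g (I (Sum.inl t)) (I₁ t)) * (∏ t, h (J' t) (J t)) * ∏ t, B t (I₁ t) (J' t)) *
    (∑ I₂ : Fin n → Fin n, (∏ a, g (I (Sum.inr (Sum.inl a))) (I₂ a)) * signCoord I₂) *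
    (∑ I₃ : Fin n → Fin n, (∏ a, g (I (Sum.inr (Sum.inr a))) (I₃ a)) * signCoord I₃)
  · simp_rw [Finset.sum_mul_sum, Finset.sum_mul]
    refine Finset.sum_congr rfl fun I₁ _ => ?_
    rw [Finset.sum_comm]
    refine Finset.sum_congr rfl fun I₃ _ => Finset.sum_congr rfl fun I₂ _ => ?_
    refine Finset.sum_congr rfl fun J' _ => ?_
    simp only [slotCoord, Fintype.prod_sum_type, Equiv.sumArrowEquivProdArrow,
      Equiv.coe_fn_symm_mk, Sum.elim_inl, Sum.elim_inr, Function.comp_def]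
    ring
  · have e1 := sum_prod_mul_signCoord g (fun a => I (Sum.inr (Sum.inl a)))
    have e2 := sum_prod_mul_signCoord g (fun a => I (Sum.inr (Sum.inr a)))
    rw [e1, e2]
    simp only [Function.comp_def]
    ring

/-- The product of the endomorphisms `B t`, `t : κ`, and of the square of the determinant form,
as a tensor over `ℝⁿ`. -/
def slotTensor (B : κ → Matrix (Fin n) (Fin n) ℝ) :
    TensorOfType (Fintype.card (UpperSlot n κ)) (Fintype.card κ) (Fin n → ℝ) :=
  (tensorBasis n _ _).equivFun.symm fun p =>
    slotCoord B (p.1 ∘ Fintype.equivFin _) (p.2 ∘ Fintype.equivFin κ)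

theorem repr_slotTensor (B : κ → Matrix (Fin n) (Fin n) ℝ)
    (p : (Fin (Fintype.card (UpperSlot n κ)) → Fin n) × (Fin (Fintype.card κ) → Fin n)) :
    (tensorBasis n _ _).repr (slotTensor κ B) p =
      slotCoord B (p.1 ∘ Fintype.equivFin _) (p.2 ∘ Fintype.equivFin κ) := by
  rw [← Module.Basis.equivFun_apply, slotTensor, LinearEquiv.apply_symm_apply]

theorem tensorMap_slotTensor (g : GL (Fin n) ℝ) (B : κ → Matrix (Fin n) (Fin n) ℝ) :
    tensorMap _ _ (glEquiv g) (slotTensor κ B) =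
      (g : Matrix (Fin n) (Fin n) ℝ).det ^ 2 • slotTensor κ fun t =>
        (g : Matrix (Fin n) (Fin n) ℝ) * B t *
          ((g⁻¹ : GL (Fin n) ℝ) : Matrix (Fin n) (Fin n) ℝ) := by
  classical
  refine (tensorBasis n _ _).ext_elem fun q => ?_
  rw [tensorBasis_repr_tensorMap, map_smul, Finsupp.smul_apply, repr_slotTensor, smul_eq_mul,
    ← sum_slotCoord, Fintype.sum_prod_type,
    ← ((Fintype.equivFin (UpperSlot n κ)).symm.arrowCongr (Equiv.refl (Fin n))).sum_comp]
  refine Finset.sum_congr rfl fun I _ => ?_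
  rw [← ((Fintype.equivFin κ).symm.arrowCongr (Equiv.refl (Fin n))).sum_comp]
  refine Finset.sum_congr rfl fun J _ => ?_
  rw [repr_slotTensor, ← (Fintype.equivFin (UpperSlot n κ)).prod_comp,
    ← (Fintype.equivFin κ).prod_comp]
  rfl

end Coordinates

/-! ### Minors of families of vectors -/

section Minors

variable {ι : Type*} {d : ℕ}

/-- The minor formed by the coordinates `s` of the vectors `v`. -/
def minor (v : Fin d → ι → ℝ) (s : Fin d → ι) : ℝ :=
  (Matrix.of fun i j => v j (s i)).det

theorem minor_eq_sum (v : Fin d → ι → ℝ) (s : Fin d → ι) :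
    minor v s = ∑ σ : Equiv.Perm (Fin d), ((Equiv.Perm.sign σ : ℤ) : ℝ) * ∏ i, v (σ i) (s i) := by
  rw [minor, ← Matrix.det_transpose, Matrix.det_apply']
  rfl

/-- The factor is the determinant of the coefficient matrix expressing `v'` through `v`. -/
theorem exists_minor_eq_mul {v v' : Fin d → ι → ℝ}
    (h : ∀ j, v' j ∈ Submodule.span ℝ (Set.range v)) :
    ∃ c : ℝ, ∀ s, minor v' s = c * minor v s := by
  choose C hC using fun j => Submodule.mem_span_range_iff_exists_fun ℝ |>.1 (h j)
  refine ⟨(Matrix.of C).det, fun s => ?_⟩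
  rw [minor, minor, ← Matrix.det_transpose (Matrix.of C), mul_comm, ← Matrix.det_mul]
  congr 1
  ext i j
  simp [Matrix.mul_apply, ← hC, mul_comm]

theorem exists_dual_family {v : Fin d → ι → ℝ} (hv : LinearIndependent ℝ v) :
    ∃ φ : Fin d → (ι → ℝ) →ₗ[ℝ] ℝ, ∀ i j, φ i (v j) = (1 : Matrix (Fin d) (Fin d) ℝ) i j := by
  obtain ⟨f, hf⟩ := (Fintype.linearCombination ℝ v).exists_leftInverse_of_injective
    (LinearMap.ker_eq_bot.2 hv.fintypeLinearCombination_injective)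
  refine ⟨fun i => LinearMap.proj i ∘ₗ f, fun i j => ?_⟩
  have := congrArg (fun F => F (Pi.single j 1) i) hf
  simpa [Matrix.one_apply, Pi.single_apply] using this

variable [Fintype ι] [DecidableEq ι]

/-- A Cauchy–Binet expansion over all index maps `s`. It transfers relations between minors to
arbitrary functionals. -/
theorem det_functional_eq_sum_minor (φ : Fin d → (ι → ℝ) →ₗ[ℝ] ℝ) (v : Fin d → ι → ℝ) :
    (Matrix.of fun i j => φ i (v j)).det =
      ∑ s : Fin d → ι, (∏ i, φ i (Pi.single (s i) 1)) * minor v s := by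
  have h := (Matrix.detRowAlternating (R := ℝ) (n := Fin d)).toMultilinearMap.map_sum
    (fun (i : Fin d) (e : ι) => φ i (Pi.single e 1) • fun j => v j e)
  have h1 : (fun i : Fin d => ∑ e, φ i (Pi.single e 1) • fun j => v j e) =
      Matrix.of fun i j => φ i (v j) := by
    ext i j
    rw [Matrix.of_apply, (φ i).pi_apply_eq_sum_univ (v j)]
    simp only [Finset.sum_apply, Pi.smul_apply, smul_eq_mul]
    refine Finset.sum_congr rfl fun e _ => ?_
    rw [mul_comm]
    congr 2
    ext x
    simp [Pi.single_apply, eq_comm]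
  rw [h1] at h
  refine h.trans (Finset.sum_congr rfl fun s _ => ?_)
  rw [MultilinearMap.map_smul_univ]
  rfl

theorem exists_minor_ne_zero {v : Fin d → ι → ℝ} (hv : LinearIndependent ℝ v) :
    ∃ s, minor v s ≠ 0 := by
  obtain ⟨φ, hφ⟩ := exists_dual_family hv
  by_contra! h
  have h1 := det_functional_eq_sum_minor φ v
  have h2 : (Matrix.of fun i j => φ i (v j)) = 1 := by
    ext i j
    exact hφ i j
  rw [h2] at h1
  simp [h] at h1

/-- Injectivity of the Plücker embedding, from products of pairs of coordinates. Fixing one nonzero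
minor turns the quadratic relations into proportionality of the minors themselves. -/
theorem mem_span_of_minor_mul_minor {v v' : Fin d → ι → ℝ} (hv : LinearIndependent ℝ v) {c : ℝ}
    (hc : c ≠ 0)
    (h : ∀ s s', minor v' s * minor v' s' = c * (minor v s * minor v s')) (j : Fin d) :
    v' j ∈ Submodule.span ℝ (Set.range v) := by
  obtain ⟨s₀, hs₀⟩ := exists_minor_ne_zero hv
  have hs₀' : minor v' s₀ ≠ 0 := by
    intro h0
    have := h s₀ s₀
    rw [h0, zero_mul, eq_comm] at this
    simp [hc, hs₀] at this
  have h1 : ∀ s, minor v' s = c * minor v s₀ / minor v' s₀ * minor v s := by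
    intro s
    field_simp
    linear_combination h s s₀
  generalize hc' : c * minor v s₀ / minor v' s₀ = c' at h1
  have hc0 : c' ≠ 0 := by
    rw [← hc']
    positivity
  have h2 : ∀ φ : Fin d → (ι → ℝ) →ₗ[ℝ] ℝ, (Matrix.of fun i j => φ i (v' j)).det =
      c' * (Matrix.of fun i j => φ i (v j)).det := by
    intro φ
    rw [det_functional_eq_sum_minor, det_functional_eq_sum_minor, Finset.mul_sum]
    exact Finset.sum_congr rfl fun s _ => by rw [h1]; ring
  obtain ⟨φ, hφ⟩ := exists_dual_family hv
  by_contra hj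
  obtain ⟨f, hf, hfv⟩ := Submodule.exists_le_ker_of_notMem hj
  have hfv' : ∀ i, f (v i) = 0 := fun i => hfv (Submodule.subset_span ⟨i, rfl⟩)
  set C : Matrix (Fin d) (Fin d) ℝ := Matrix.of fun i j => φ i (v' j) with hC
  have hdet : C.det ≠ 0 := by
    rw [h2 φ]
    have : (Matrix.of fun i j => φ i (v j)) = 1 := by
      ext i j
      exact hφ i j
    simpa [this] using hc0
  -- Replacing `φ i` by `f`, which kills all `v j`, creates a zero row on the `v` side. So all
  -- Cramer numerators vanish, and `det C ≠ 0` forces `f (v' j) = 0`.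
  have h3 : Matrix.cramer C.transpose (fun i => f (v' i)) = 0 := by
    ext i
    rw [Matrix.cramer_transpose_apply]
    have h4 := h2 (Function.update φ i f)
    have h5 : (Matrix.of fun k j => (Function.update φ i f) k (v' j)) =
        C.updateRow i fun j => f (v' j) := by
      ext k j
      by_cases hk : k = i
      · subst hk; simp
      · simp [hk, hC]
    rw [← h5, h4, Pi.zero_apply, Matrix.det_eq_zero_of_row_eq_zero i, mul_zero]
    intro k
    simp [hfv']
  have h6 := Matrix.mulVec_cramer C.transpose (fun i => f (v' i))
  rw [h3, Matrix.mulVec_zero, Matrix.det_transpose] at h6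
  have h7 := congrFun h6 j
  simp [hdet] at h7
  exact hf h7

end Minors

/-! ### Words in matrix entries -/

section Words

variable {n k : ℕ}

/-- Words of length `k` in the entries of a matrix (where the flag is `true`) and in those of the
identity matrix (where it is `false`). -/
abbrev EntryWord (n k : ℕ) : Type := (Fin k → Bool) × (Fin k → Fin n) × (Fin k → Fin n)

/-- The products of entries of `A` and of the identity matrix given by all words of length `k`. -/
def wordEval (k : ℕ) (A : Matrix (Fin n) (Fin n) ℝ) (w : EntryWord n k) : ℝ :=
  ∏ t, (if w.1 t then A else 1) (w.2.1 t) (w.2.2 t)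

theorem exists_word_of_card_le [NeZero n] (k : ℕ) (l : Multiset (Fin n × Fin n))
    (hl : l.card ≤ k) :
    ∃ w : EntryWord n k, ∀ A : Matrix (Fin n) (Fin n) ℝ,
      wordEval k A w = (l.map fun ij => A ij.1 ij.2).prod := by
  induction k generalizing l with
  | zero =>
    obtain rfl : l = 0 := by simpa using hl
    exact ⟨⟨Fin.elim0, Fin.elim0, Fin.elim0⟩, fun A => by simp [wordEval]⟩
  | succ k ih =>
    induction l using Multiset.induction with
    | empty =>
      -- Short monomials are padded by the `(0, 0)` entry of the identity, which is `1`; this needs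
      -- `n ≠ 0`.
      refine ⟨⟨fun _ => false, fun _ => 0, fun _ => 0⟩, fun A => by simp [wordEval]⟩
    | cons a l _ =>
      obtain ⟨w, hw⟩ := ih l (by simpa using hl)
      refine ⟨⟨Fin.cons true w.1, Fin.cons a.1 w.2.1, Fin.cons a.2 w.2.2⟩, fun A => ?_⟩
      rw [Multiset.map_cons, Multiset.prod_cons, ← hw, wordEval, Fin.prod_univ_succ]
      simp [wordEval]

theorem exists_functional_of_totalDegree_le [NeZero n] (k : ℕ)
    (p : MvPolynomial (Fin n × Fin n) ℝ) (hp : p.totalDegree ≤ k) :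
    ∃ φ : (EntryWord n k → ℝ) →ₗ[ℝ] ℝ, ∀ A : Matrix (Fin n) (Fin n) ℝ,
      φ (wordEval k A) = MvPolynomial.eval (fun ij => A ij.1 ij.2) p := by
  have h : ∀ f : p.support, ∃ w : EntryWord n k, ∀ A : Matrix (Fin n) (Fin n) ℝ,
      wordEval k A w = (f.1.toMultiset.map fun ij => A ij.1 ij.2).prod := by
    intro f
    refine exists_word_of_card_le k _ ?_
    rw [Finsupp.card_toMultiset]
    exact (MvPolynomial.le_totalDegree f.2).trans hp
  choose w hw using h
  refine ⟨∑ f : p.support, p.coeff f.1 •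
    (LinearMap.proj (w f) : (EntryWord n k → ℝ) →ₗ[ℝ] ℝ), fun A => ?_⟩
  rw [MvPolynomial.eval_eq, LinearMap.sum_apply,
    ← Finset.sum_coe_sort p.support]
  refine Finset.sum_congr rfl fun f _ => ?_
  rw [LinearMap.smul_apply, LinearMap.proj_apply, hw, smul_eq_mul, Finsupp.toMultiset_map,
    Finsupp.prod_toMultiset,
    Finsupp.prod_mapDomain_index (fun _ => pow_zero _) (fun _ _ _ => pow_add _ _ _)]
  rfl

/-- Conjugation fixes the identity factors, so the pattern of flags is kept and only the indices
mix. -/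
theorem exists_linearMap_wordEval_conj (k : ℕ) (g : GL (Fin n) ℝ) :
    ∃ R : (EntryWord n k → ℝ) →ₗ[ℝ] (EntryWord n k → ℝ), ∀ A : Matrix (Fin n) (Fin n) ℝ,
      wordEval k ((g : Matrix (Fin n) (Fin n) ℝ) * A *
        ((g⁻¹ : GL (Fin n) ℝ) : Matrix (Fin n) (Fin n) ℝ)) = R (wordEval k A) := by
  refine ⟨LinearMap.pi fun w => ∑ I : Fin k → Fin n, ∑ J : Fin k → Fin n,
    ((∏ t, (g : Matrix (Fin n) (Fin n) ℝ) (w.2.1 t) (I t)) *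
      ∏ t, ((g⁻¹ : GL (Fin n) ℝ) : Matrix (Fin n) (Fin n) ℝ) (J t) (w.2.2 t)) •
      LinearMap.proj (w.1, I, J), fun A => ?_⟩
  ext w
  simp only [LinearMap.pi_apply, LinearMap.sum_apply, LinearMap.smul_apply, LinearMap.proj_apply,
    smul_eq_mul]
  refine Eq.trans ?_ (sum_prod_mul_prod_mul _ _ (fun t => if w.1 t then A else 1) _ _).symm
  refine Finset.prod_congr rfl fun t _ => ?_
  split_ifs
  · rfl
  · rw [mul_one, ← Units.val_mul, mul_inv_cancel, Units.val_one]

end Words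

/-! ### Algebraic subgroups and their normalizers -/

section Normalizer

variable {n : ℕ} {G : Subgroup (GL (Fin n) ℝ)}

theorem IsAlgebraicSubgroup.exists_totalDegree_le (hG : IsAlgebraicSubgroup G) :
    ∃ (k : ℕ) (S : Set (MvPolynomial (Fin n × Fin n) ℝ)), (∀ p ∈ S, p.totalDegree ≤ k) ∧
      ∀ g : GL (Fin n) ℝ, g ∈ G ↔ ∀ p ∈ S,
        MvPolynomial.eval (fun ij => (g : Matrix (Fin n) (Fin n) ℝ) ij.1 ij.2) p = 0 := by
  obtain ⟨S, hS⟩ := hG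
  obtain ⟨T, hTS, hT⟩ := (Submodule.fg_span_iff_fg_span_finset_subset S).1
    (IsNoetherian.noetherian (Ideal.span S))
  refine ⟨T.sup MvPolynomial.totalDegree, T, fun p hp => Finset.le_sup hp, fun g => ?_⟩
  rw [hS]
  refine ⟨fun h p hp => h p (hTS hp), fun h p hp => ?_⟩
  have h1 : Ideal.span (T : Set (MvPolynomial (Fin n × Fin n) ℝ)) ≤ RingHom.ker
      (MvPolynomial.eval fun ij => (g : Matrix (Fin n) (Fin n) ℝ) ij.1 ij.2) :=
    Ideal.span_le.2 h
  have h2 : p ∈ Ideal.span S := Submodule.subset_span hp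
  exact h1 (hT.le h2)

theorem conj_mem_of_wordEval_mem_span [NeZero n] {k : ℕ}
    {S : Set (MvPolynomial (Fin n × Fin n) ℝ)} (hk : ∀ p ∈ S, p.totalDegree ≤ k)
    (hS : ∀ g : GL (Fin n) ℝ, g ∈ G ↔ ∀ p ∈ S,
      MvPolynomial.eval (fun ij => (g : Matrix (Fin n) (Fin n) ℝ) ij.1 ij.2) p = 0)
    {d : ℕ} {A : Fin d → GL (Fin n) ℝ} (hA : ∀ j, A j ∈ G)
    (hspan : ∀ h ∈ G, wordEval k (h : Matrix (Fin n) (Fin n) ℝ) ∈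
      Submodule.span ℝ (Set.range fun j => wordEval k (A j : Matrix (Fin n) (Fin n) ℝ)))
    {g : GL (Fin n) ℝ}
    (hg : ∀ j, wordEval k ((g * A j * g⁻¹ : GL (Fin n) ℝ) : Matrix (Fin n) (Fin n) ℝ) ∈
      Submodule.span ℝ (Set.range fun j => wordEval k (A j : Matrix (Fin n) (Fin n) ℝ)))
    {h : GL (Fin n) ℝ} (hh : h ∈ G) : g * h * g⁻¹ ∈ G := by
  obtain ⟨R, hR⟩ := exists_linearMap_wordEval_conj k g
  set X := Submodule.span ℝ (Set.range fun j => wordEval k (A j : Matrix (Fin n) (Fin n) ℝ))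
  have h1 : X ≤ X.comap R := by
    refine Submodule.span_le.2 ?_
    rintro _ ⟨j, rfl⟩
    have := hg j
    rw [Units.val_mul, Units.val_mul, hR] at this
    exact this
  have h2 : wordEval k ((g * h * g⁻¹ : GL (Fin n) ℝ) : Matrix (Fin n) (Fin n) ℝ) ∈ X := by
    rw [Units.val_mul, Units.val_mul, hR]
    exact h1 (hspan h hh)
  refine (hS _).2 fun p hp => ?_
  obtain ⟨φ, hφ⟩ := exists_functional_of_totalDegree_le k p (hk p hp)
  rw [← hφ]
  have h3 : X ≤ LinearMap.ker φ := by
    refine Submodule.span_le.2 ?_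
    rintro _ ⟨j, rfl⟩
    rw [SetLike.mem_coe, LinearMap.mem_ker, hφ]
    exact (hS _).1 (hA j) p hp
  exact h3 h2

theorem exists_wordEval_basis (G : Subgroup (GL (Fin n) ℝ)) (k : ℕ) :
    ∃ (d : ℕ) (A : Fin d → GL (Fin n) ℝ), (∀ j, A j ∈ G) ∧
      LinearIndependent ℝ (fun j => wordEval k (A j : Matrix (Fin n) (Fin n) ℝ)) ∧
      ∀ h ∈ G, wordEval k (h : Matrix (Fin n) (Fin n) ℝ) ∈
        Submodule.span ℝ (Set.range fun j => wordEval k (A j : Matrix (Fin n) (Fin n) ℝ)) := by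
  obtain ⟨b, hb, hspan, hli⟩ := exists_linearIndependent ℝ
    ((fun h : GL (Fin n) ℝ => wordEval k (h : Matrix (Fin n) (Fin n) ℝ)) '' G)
  have : Finite b := hli.finite
  obtain ⟨d, ⟨e⟩⟩ := Finite.exists_equiv_fin b
  choose A hA hAe using fun j => hb (e.symm j).2
  have hr : Set.range (fun j => wordEval k (A j : Matrix (Fin n) (Fin n) ℝ)) = b := by
    simp only [hAe]
    ext x
    simp only [Set.mem_range]
    exact ⟨fun ⟨j, hj⟩ => hj ▸ (e.symm j).2, fun hx => ⟨e ⟨x, hx⟩, by simp⟩⟩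
  refine ⟨d, A, hA, ?_, fun h hh => ?_⟩
  · simp only [hAe]
    exact hli.comp _ e.symm.injective
  · rw [hr, hspan]
    exact Submodule.subset_span ⟨h, hh, rfl⟩

end Normalizer

/-! ### The tensor whose projective stabilizer is the normalizer -/

section WedgeTensor

variable {n d k : ℕ}

/-- Positions in two families of `d` words of length `k`. -/
abbrev WordSlot (d k : ℕ) : Type := (Fin d × Fin k) ⊕ (Fin d × Fin k)

/-- The matrices to be multiplied in the term of `wedgeTensor` given by permutations `σ`, `τ`. -/
def slotMatrix (b : WordSlot d k → Bool) (N : ℕ) (A : Fin d → Matrix (Fin n) (Fin n) ℝ)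
    (σ τ : Equiv.Perm (Fin d)) : WordSlot d k ⊕ Fin N → Matrix (Fin n) (Fin n) ℝ :=
  Sum.elim (fun x => if b x then Sum.elim (fun q => A (σ q.1)) (fun q => A (τ q.1)) x else 1)
    fun _ => 1

/-- The tensor with components the products of two minors of the words in the entries of the
matrices `A j`, for the pattern `b` of matrices `A j` and identity matrices, padded by `N` identity
matrices and twisted by the square of the determinant form. -/
def wedgeTensor (b : WordSlot d k → Bool) (N : ℕ) (A : Fin d → Matrix (Fin n) (Fin n) ℝ) :
    TensorOfType (Fintype.card (UpperSlot n (WordSlot d k ⊕ Fin N)))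
      (Fintype.card (WordSlot d k ⊕ Fin N)) (Fin n → ℝ) :=
  ∑ σ : Equiv.Perm (Fin d), ∑ τ : Equiv.Perm (Fin d),
    (((Equiv.Perm.sign σ : ℤ) : ℝ) * ((Equiv.Perm.sign τ : ℤ) : ℝ)) •
      slotTensor (WordSlot d k ⊕ Fin N) (slotMatrix b N A σ τ)

theorem tensorMap_wedgeTensor (g : GL (Fin n) ℝ) (b : WordSlot d k → Bool) (N : ℕ)
    (A : Fin d → Matrix (Fin n) (Fin n) ℝ) :
    tensorMap _ _ (glEquiv g) (wedgeTensor b N A) =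
      (g : Matrix (Fin n) (Fin n) ℝ).det ^ 2 • wedgeTensor b N fun j =>
        (g : Matrix (Fin n) (Fin n) ℝ) * A j *
          ((g⁻¹ : GL (Fin n) ℝ) : Matrix (Fin n) (Fin n) ℝ) := by
  have h1 : ∀ σ τ : Equiv.Perm (Fin d), (fun t => (g : Matrix (Fin n) (Fin n) ℝ) *
      slotMatrix b N A σ τ t * ((g⁻¹ : GL (Fin n) ℝ) : Matrix (Fin n) (Fin n) ℝ)) =
      slotMatrix b N (fun j => (g : Matrix (Fin n) (Fin n) ℝ) * A j *
        ((g⁻¹ : GL (Fin n) ℝ) : Matrix (Fin n) (Fin n) ℝ)) σ τ := by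
    intro σ τ
    have h2 : (g : Matrix (Fin n) (Fin n) ℝ) * 1 *
        ((g⁻¹ : GL (Fin n) ℝ) : Matrix (Fin n) (Fin n) ℝ) = 1 := by
      rw [mul_one, ← Units.val_mul, mul_inv_cancel, Units.val_one]
    ext1 t
    rcases t with (x | x) | x
    · by_cases hb : b (Sum.inl x) = true <;> simp [slotMatrix, hb]
    · by_cases hb : b (Sum.inr x) = true <;> simp [slotMatrix, hb]
    · exact h2
  refine (map_sum (tensorMap _ _ (glEquiv g)).toLinearMap _ _).trans ?_
  rw [wedgeTensor, Finset.smul_sum]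
  refine Finset.sum_congr rfl fun σ _ => ?_
  refine (map_sum (tensorMap _ _ (glEquiv g)).toLinearMap _ _).trans ?_
  rw [Finset.smul_sum]
  refine Finset.sum_congr rfl fun τ _ => ?_
  refine (map_smul (tensorMap _ _ (glEquiv g)).toLinearMap _ _).trans ?_
  rw [LinearEquiv.coe_coe, tensorMap_slotTensor, h1, smul_comm]

/-- Scalars conjugate trivially, so only the squared determinant twist is seen. -/
theorem tensorMap_scalar_wedgeTensor (l : ℝˣ) (b : WordSlot d k → Bool) (N : ℕ)
    (A : Fin d → Matrix (Fin n) (Fin n) ℝ) :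
    tensorMap _ _ (glEquiv (Units.map (algebraMap ℝ (Matrix (Fin n) (Fin n) ℝ)).toMonoidHom l))
      (wedgeTensor b N A) = ((l : ℝ) ^ n) ^ 2 • wedgeTensor b N A := by
  have h : ∀ u : ℝˣ, ((Units.map (algebraMap ℝ (Matrix (Fin n) (Fin n) ℝ)).toMonoidHom u :
      GL (Fin n) ℝ) : Matrix (Fin n) (Fin n) ℝ) = algebraMap ℝ _ (u : ℝ) := fun _ => rfl
  have h1 : (algebraMap ℝ (Matrix (Fin n) (Fin n) ℝ) l).det = (l : ℝ) ^ n := by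
    simp [Matrix.algebraMap_eq_diagonal]
  have h2 : (fun j => algebraMap ℝ (Matrix (Fin n) (Fin n) ℝ) l * A j *
      algebraMap ℝ (Matrix (Fin n) (Fin n) ℝ) (l⁻¹ : ℝˣ)) = A := by
    ext1 j
    rw [Algebra.commutes, mul_assoc, ← map_mul, Units.mul_inv, map_one, mul_one]
  rw [tensorMap_wedgeTensor, ← map_inv, h, h, h1, h2]

/-- The word read off at the positions `(i, t)`, `t : Fin k`. -/
def wordAt (b : Fin d × Fin k → Bool) (I J : Fin d × Fin k → Fin n) (i : Fin d) :
    EntryWord n k :=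
  (fun t => b (i, t), fun t => I (i, t), fun t => J (i, t))

theorem minor_wordAt (A : Fin d → Matrix (Fin n) (Fin n) ℝ) (b : Fin d × Fin k → Bool)
    (I J : Fin d × Fin k → Fin n) :
    minor (fun j => wordEval k (A j)) (wordAt b I J) =
      ∑ σ : Equiv.Perm (Fin d), ((Equiv.Perm.sign σ : ℤ) : ℝ) *
        ∏ x : Fin d × Fin k, (if b x then A (σ x.1) else 1) (I x) (J x) := by
  rw [minor_eq_sum]
  refine Finset.sum_congr rfl fun σ _ => ?_
  rw [Fintype.prod_prod_type]
  rfl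

theorem basis_repr_sum_sum_smul {ι X P Q : Type*} [AddCommGroup X] [Module ℝ X] [Fintype P]
    [Fintype Q] (b : Module.Basis ι ℝ X) (a : P → Q → ℝ) (x : P → Q → X) (q : ι) :
    b.repr (∑ σ, ∑ τ, a σ τ • x σ τ) q = ∑ σ, ∑ τ, a σ τ * b.repr (x σ τ) q := by
  simp only [map_sum, map_smul, Finsupp.coe_finsetSum, Finset.sum_apply, Finsupp.coe_smul,
    Pi.smul_apply, smul_eq_mul]

theorem repr_wedgeTensor (b : WordSlot d k → Bool) (N : ℕ)
    (A : Fin d → Matrix (Fin n) (Fin n) ℝ)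
    (I : UpperSlot n (WordSlot d k ⊕ Fin N) → Fin n) (J : WordSlot d k ⊕ Fin N → Fin n) :
    (tensorBasis n _ _).repr (wedgeTensor b N A)
        (I ∘ (Fintype.equivFin _).symm, J ∘ (Fintype.equivFin _).symm) =
      signCoord (I ∘ Sum.inr ∘ Sum.inl) * signCoord (I ∘ Sum.inr ∘ Sum.inr) *
        (∏ x, (1 : Matrix (Fin n) (Fin n) ℝ) (I (Sum.inl (Sum.inr x))) (J (Sum.inr x))) *
        (minor (fun j => wordEval k (A j)) (wordAt (fun x => b (Sum.inl x))
            (fun x => I (Sum.inl (Sum.inl (Sum.inl x)))) fun x => J (Sum.inl (Sum.inl x))) *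
          minor (fun j => wordEval k (A j)) (wordAt (fun x => b (Sum.inr x))
            (fun x => I (Sum.inl (Sum.inl (Sum.inr x)))) fun x => J (Sum.inl (Sum.inr x)))) := by
  rw [minor_wordAt, minor_wordAt, Finset.sum_mul_sum, wedgeTensor, Finset.mul_sum]
  refine (basis_repr_sum_sum_smul (tensorBasis n _ _)
    (fun σ τ : Equiv.Perm (Fin d) => ((Equiv.Perm.sign σ : ℤ) : ℝ) * ((Equiv.Perm.sign τ : ℤ) : ℝ))
    (fun σ τ => slotTensor (WordSlot d k ⊕ Fin N) (slotMatrix b N A σ τ)) _).trans ?_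
  refine Finset.sum_congr rfl fun σ _ => ?_
  rw [Finset.mul_sum]
  refine Finset.sum_congr rfl fun τ _ => ?_
  rw [repr_slotTensor]
  have e1 : (I ∘ (Fintype.equivFin _).symm) ∘ Fintype.equivFin _ = I := by
    ext x; simp
  have e2 : (J ∘ (Fintype.equivFin _).symm) ∘ Fintype.equivFin _ = J := by
    ext x; simp
  simp only [e1, e2]
  rw [slotCoord, Fintype.prod_sum_type, Fintype.prod_sum_type]
  simp only [slotMatrix, Sum.elim_inl, Sum.elim_inr]
  ring

theorem wedgeTensor_eq_smul {A A' : Fin d → Matrix (Fin n) (Fin n) ℝ} {c : ℝ}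
    (h : ∀ s, minor (fun j => wordEval k (A' j)) s = c * minor (fun j => wordEval k (A j)) s)
    (b : WordSlot d k → Bool) (N : ℕ) :
    wedgeTensor b N A' = c ^ 2 • wedgeTensor b N A := by
  refine (tensorBasis n _ _).ext_elem fun p => ?_
  obtain ⟨I, hI⟩ : ∃ I, p.1 = I ∘ (Fintype.equivFin _).symm :=
    ⟨p.1 ∘ Fintype.equivFin _, by ext x; simp⟩
  obtain ⟨J, hJ⟩ : ∃ J, p.2 = J ∘ (Fintype.equivFin _).symm :=
    ⟨p.2 ∘ Fintype.equivFin _, by ext x; simp⟩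
  obtain ⟨p₁, p₂⟩ := p
  dsimp only at hI hJ
  subst hI hJ
  rw [map_smul, Finsupp.smul_apply, repr_wedgeTensor, repr_wedgeTensor, h, h, smul_eq_mul]
  ring

/-- The pattern is chosen before `N`, because `N` will be the number of the pattern. Constant
indices in the padding slots and identity indices in the determinant slots make the extra factors
equal to `1`. -/
theorem exists_repr_wedgeTensor [NeZero n] (s s' : Fin d → EntryWord n k) :
    ∃ b : WordSlot d k → Bool, ∀ N, ∃ p, ∀ A : Fin d → Matrix (Fin n) (Fin n) ℝ,
      (tensorBasis n _ _).repr (wedgeTensor b N A) p =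
        minor (fun j => wordEval k (A j)) s * minor (fun j => wordEval k (A j)) s' := by
  refine ⟨Sum.elim (fun x => (s x.1).1 x.2) fun x => (s' x.1).1 x.2, fun N => ?_⟩
  refine ⟨(Sum.elim (Sum.elim (Sum.elim (fun x => (s x.1).2.1 x.2) fun x => (s' x.1).2.1 x.2)
    fun _ => 0) (Sum.elim id id) ∘ (Fintype.equivFin _).symm,
    Sum.elim (Sum.elim (fun x => (s x.1).2.2 x.2) fun x => (s' x.1).2.2 x.2)
      (fun _ => 0) ∘ (Fintype.equivFin _).symm), fun A => ?_⟩
  rw [repr_wedgeTensor]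
  simp only [← Function.comp_assoc, Sum.elim_comp_inr, Sum.elim_comp_inl, signCoord_id, one_mul]
  refine (congrArg₂ (· * ·) (Finset.prod_eq_one fun x _ => ?_) rfl).trans (one_mul _)
  exact Matrix.one_apply_eq (0 : Fin n)

end WedgeTensor

/-! ### Projective stabilizers and the stabilizer tensor of the normalizer -/

section StabilizerTensor

variable {n : ℕ}

theorem tensorSum_component {V : Type*} [AddCommGroup V] [Module ℝ V] {m : ℕ} {r s : Fin m → ℕ}
    (h : Function.Injective fun i => (r i, s i)) (τ : ∀ i, TensorOfType (r i) (s i) V)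
    (i : Fin m) : (tensorSum τ) (r i, s i) = τ i := by
  rw [tensorSum, DirectSum.sum_apply, Finset.sum_eq_single i]
  · exact DFinsupp.single_eq_same
  · intro j _ hj
    exact DFinsupp.single_eq_of_ne fun e => hj (h e).symm
  · simp

theorem tensorSum_smul {V : Type*} [AddCommGroup V] [Module ℝ V] {m : ℕ} {r s : Fin m → ℕ}
    (c : ℝ) (τ : ∀ i, TensorOfType (r i) (s i) V) :
    tensorSum (fun i => c • τ i) = c • tensorSum τ := by
  simp only [tensorSum, map_smul, Finset.smul_sum]

theorem mixedTensorMap_tensorSum {V W : Type*} [AddCommGroup V] [Module ℝ V] [AddCommGroup W]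
    [Module ℝ W] {m : ℕ} {r s : Fin m → ℕ} (α : V ≃ₗ[ℝ] W)
    (τ : ∀ i, TensorOfType (r i) (s i) V) :
    mixedTensorMap α (tensorSum τ) = tensorSum fun i => tensorMap (r i) (s i) α (τ i) := by
  rw [tensorSum, map_sum, tensorSum]
  refine Finset.sum_congr rfl fun i _ => ?_
  exact DFinsupp.mapRange_single (hf := fun p => (tensorMap p.1 p.2 α).map_zero)

/-- Distinct types let the components be read off separately, but with one common scalar. -/
theorem projTensorMap_mk_eq_iff {V W : Type*} [AddCommGroup V] [Module ℝ V] [AddCommGroup W]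
    [Module ℝ W] {m : ℕ} {r s : Fin m → ℕ} (h : Function.Injective fun i => (r i, s i))
    (α : V ≃ₗ[ℝ] W) (τ : ∀ i, TensorOfType (r i) (s i) V) (hτ : tensorSum τ ≠ 0)
    (τ' : ∀ i, TensorOfType (r i) (s i) W) (hτ' : tensorSum τ' ≠ 0) :
    projTensorMap α (Projectivization.mk ℝ (tensorSum τ) hτ) =
        Projectivization.mk ℝ (tensorSum τ') hτ' ↔
      ∃ c : ℝ, c ≠ 0 ∧ ∀ i, tensorMap (r i) (s i) α (τ i) = c • τ' i := by
  rw [projTensorMap, Projectivization.map_mk, Projectivization.mk_eq_mk_iff']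
  have e : (mixedTensorMap α).toLinearMap (tensorSum τ) =
    tensorSum fun i => tensorMap (r i) (s i) α (τ i) := mixedTensorMap_tensorSum α τ
  constructor
  · rintro ⟨c, hc⟩
    rw [e, ← tensorSum_smul] at hc
    refine ⟨c, ?_, fun i => ?_⟩
    · rintro rfl
      rw [tensorSum_smul, zero_smul, ← e, LinearEquiv.coe_coe, eq_comm,
        LinearEquiv.map_eq_zero_iff] at hc
      exact hτ hc
    · rw [← tensorSum_component h (fun i => tensorMap (r i) (s i) α (τ i)), ← hc,
        tensorSum_component h]
  · rintro ⟨c, _, hc⟩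
    refine ⟨c, ?_⟩
    rw [e, ← tensorSum_smul]
    congr 1
    ext1 i
    exact (hc i).symm

/-- The tensors `u i` have pairwise distinct types, they do not all vanish, the line of their sum
has stabilizer `H`, on which `H` acts by a positive character, and unless `n = 0` every positive
multiple of the family `u` is obtained from `u` by a linear automorphism. -/
structure IsStabilizerTensor (H : Subgroup (GL (Fin n) ℝ)) {m : ℕ} {r s : Fin m → ℕ}
    (u : ∀ i, TensorOfType (r i) (s i) (Fin n → ℝ)) : Prop where
  injective : Function.Injective fun i => (r i, s i)
  exists_ne_zero : ∃ i, u i ≠ 0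
  mem_of_eq_smul : ∀ (g : GL (Fin n) ℝ) (c : ℝ), c ≠ 0 →
    (∀ i, tensorMap (r i) (s i) (glEquiv g) (u i) = c • u i) → g ∈ H
  exists_pos : ∀ g ∈ H, ∃ c : ℝ, 0 < c ∧ (n = 0 → c = 1) ∧
    ∀ i, tensorMap (r i) (s i) (glEquiv g) (u i) = c • u i
  exists_scaling : n ≠ 0 → ∀ c : ℝ, 0 < c → ∃ g : GL (Fin n) ℝ,
    ∀ i, tensorMap (r i) (s i) (glEquiv g) (u i) = c • u i

theorem IsStabilizerTensor.tensorSum_ne_zero {H : Subgroup (GL (Fin n) ℝ)} {m : ℕ}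
    {r s : Fin m → ℕ} {u : ∀ i, TensorOfType (r i) (s i) (Fin n → ℝ)}
    (hu : IsStabilizerTensor H u) : tensorSum u ≠ 0 := by
  obtain ⟨i, hi⟩ := hu.exists_ne_zero
  intro h
  have := tensorSum_component hu.injective u i
  rw [h] at this
  exact hi this.symm

theorem glEquiv_one : glEquiv (1 : GL (Fin n) ℝ) = LinearEquiv.refl ℝ _ := by
  ext1 v
  simp [glEquiv_apply]

theorem tensorMap_refl (r s : ℕ) {V : Type*} [AddCommGroup V] [Module ℝ V] :
    tensorMap r s (LinearEquiv.refl ℝ V) = LinearEquiv.refl ℝ _ := by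
  apply LinearEquiv.toLinearMap_injective
  refine TensorProduct.ext ?_
  refine PiTensorProduct.ext ?_
  ext1 v
  refine PiTensorProduct.ext ?_
  ext1 w
  simp [tensorMap]

theorem tensorMap_trans (r s : ℕ) {V W X : Type*} [AddCommGroup V] [Module ℝ V] [AddCommGroup W]
    [Module ℝ W] [AddCommGroup X] [Module ℝ X] (α : V ≃ₗ[ℝ] W) (β : W ≃ₗ[ℝ] X) :
    tensorMap r s (α.trans β) = (tensorMap r s α).trans (tensorMap r s β) := by
  apply LinearEquiv.toLinearMap_injective
  refine TensorProduct.ext ?_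
  refine PiTensorProduct.ext ?_
  ext1 v
  refine PiTensorProduct.ext ?_
  ext1 w
  simp [tensorMap]
  rfl

theorem tensorMap_trans_apply (r s : ℕ) {V W X : Type*} [AddCommGroup V] [Module ℝ V]
    [AddCommGroup W] [Module ℝ W] [AddCommGroup X] [Module ℝ X] (α : V ≃ₗ[ℝ] W) (β : W ≃ₗ[ℝ] X)
    (t : TensorOfType r s V) :
    tensorMap r s (α.trans β) t = tensorMap r s β (tensorMap r s α t) := by
  rw [tensorMap_trans, LinearEquiv.trans_apply]

theorem tensorMap_symm_apply_self (r s : ℕ) {V W : Type*} [AddCommGroup V] [Module ℝ V]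
    [AddCommGroup W] [Module ℝ W] (α : V ≃ₗ[ℝ] W) (t : TensorOfType r s V) :
    tensorMap r s α.symm (tensorMap r s α t) = t := by
  rw [← tensorMap_trans_apply, LinearEquiv.self_trans_symm, tensorMap_refl, LinearEquiv.refl_apply]

theorem glEquiv_inv (g : GL (Fin n) ℝ) : glEquiv g⁻¹ = (glEquiv g).symm := by
  ext1 v
  rw [glEquiv_symm_apply, glEquiv_apply]

/-- For `n = 0` the group is trivial and cannot rescale anything, so the character is required to be
`1` instead. -/
theorem exists_isStabilizerTensor_zero (H : Subgroup (GL (Fin 0) ℝ)) :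
    ∃ (m : ℕ) (r s : Fin m → ℕ) (u : ∀ i, TensorOfType (r i) (s i) (Fin 0 → ℝ)),
      IsStabilizerTensor H u := by
  refine ⟨1, fun _ => 0, fun _ => 0, fun _ => tensorBasis 0 0 0 (Fin.elim0, Fin.elim0), ?_⟩
  refine ⟨fun i j _ => Subsingleton.elim i j, ⟨0, (tensorBasis 0 0 0).ne_zero _⟩, ?_, ?_,
    fun h => absurd rfl h⟩
  · intro g _ _ _
    rw [Subsingleton.elim g 1]
    exact H.one_mem
  · intro g _
    refine ⟨1, one_pos, fun _ => rfl, fun i => ?_⟩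
    rw [Subsingleton.elim g 1, glEquiv_one, tensorMap_refl, one_smul]
    rfl

theorem exists_isStabilizerTensor_normalizer {G : Subgroup (GL (Fin n) ℝ)}
    (hG : IsAlgebraicSubgroup G) :
    ∃ (m : ℕ) (r s : Fin m → ℕ) (u : ∀ i, TensorOfType (r i) (s i) (Fin n → ℝ)),
      IsStabilizerTensor (Subgroup.normalizer (G : Set (GL (Fin n) ℝ))) u := by
  rcases Nat.eq_zero_or_pos n with rfl | hn
  · exact exists_isStabilizerTensor_zero _
  have : NeZero n := ⟨hn.ne'⟩
  obtain ⟨k, S, hk, hS⟩ := hG.exists_totalDegree_le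
  obtain ⟨d, A, hA, hli, hspan⟩ := exists_wordEval_basis G k
  set e := Fintype.equivFin (WordSlot d k → Bool)
  set A' : Fin d → Matrix (Fin n) (Fin n) ℝ := fun j => (A j : Matrix (Fin n) (Fin n) ℝ)
  have hne : ∃ i : Fin (Fintype.card (WordSlot d k → Bool)),
      wedgeTensor (n := n) (e.symm i) i A' ≠ 0 := by
    obtain ⟨s, hs⟩ := exists_minor_ne_zero hli
    obtain ⟨b, hb⟩ := exists_repr_wedgeTensor s s
    obtain ⟨p, hp⟩ := hb (e b)
    refine ⟨e b, fun h => ?_⟩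
    have h1 := hp A'
    rw [e.symm_apply_apply] at h
    rw [h, LinearEquiv.map_zero, Finsupp.zero_apply, eq_comm, mul_self_eq_zero] at h1
    exact hs h1
  refine ⟨Fintype.card (WordSlot d k → Bool),
    fun i => Fintype.card (UpperSlot n (WordSlot d k ⊕ Fin i)),
    fun i => Fintype.card (WordSlot d k ⊕ Fin i),
    -- The number `i` of the pattern is also the amount of padding, so the covariant degrees are
    -- distinct.
    fun i => wedgeTensor (e.symm i) i A', ?_, ?_, ?_, ?_, ?_⟩
  · intro i j h
    have := congrArg Prod.snd h
    simp only [Fintype.card_sum, Fintype.card_fin] at this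
    exact Fin.ext (by omega)
  · exact hne
  · have key : ∀ (g : GL (Fin n) ℝ) (c : ℝ), c ≠ 0 →
        (∀ i : Fin (Fintype.card (WordSlot d k → Bool)),
          tensorMap _ _ (glEquiv g) (wedgeTensor (e.symm i) i A') =
            c • wedgeTensor (e.symm i) i A') → ∀ h ∈ G, g * h * g⁻¹ ∈ G := by
      intro g c hc h h₀ hh
      have hdet : (g : Matrix (Fin n) (Fin n) ℝ).det ≠ 0 :=
        ((Matrix.isUnit_iff_isUnit_det _).1 g.isUnit).ne_zero
      refine conj_mem_of_wordEval_mem_span hk hS hA hspan (fun j => ?_) hh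
      refine mem_span_of_minor_mul_minor
        (v' := fun j => wordEval k ((g * A j * g⁻¹ : GL (Fin n) ℝ) : Matrix (Fin n) (Fin n) ℝ))
        (c := c / (g : Matrix (Fin n) (Fin n) ℝ).det ^ 2) hli (by positivity) (fun s s' => ?_) j
      obtain ⟨b, hb⟩ := exists_repr_wedgeTensor s s'
      obtain ⟨p, hp⟩ := hb (e b)
      have h1 := h (e b)
      rw [tensorMap_wedgeTensor, e.symm_apply_apply] at h1
      have h2 := congrArg (fun t => (tensorBasis n _ _).repr t p) h1
      simp only [map_smul, Finsupp.smul_apply, hp, smul_eq_mul] at h2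
      simp only [Units.val_mul]
      field_simp
      linear_combination h2
    intro g c hc h
    -- `key` gives only `g G g⁻¹ ⊆ G`; the reverse inclusion is `key` for `g⁻¹`, which acts by
    -- `c⁻¹`.
    have hinv : ∀ i : Fin (Fintype.card (WordSlot d k → Bool)),
        tensorMap _ _ (glEquiv g⁻¹) (wedgeTensor (e.symm i) i A') =
          c⁻¹ • wedgeTensor (e.symm i) i A' := by
      intro i
      have h1 := tensorMap_symm_apply_self _ _ (glEquiv g) (wedgeTensor (e.symm i) i A')
      rw [h i, LinearEquiv.map_smul] at h1
      rw [glEquiv_inv]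
      exact (inv_smul_smul₀ hc _).symm.trans (congrArg (c⁻¹ • ·) h1)
    rw [Subgroup.mem_normalizer_iff]
    refine fun x => ⟨key g c hc h x, fun hx => ?_⟩
    have := key g⁻¹ c⁻¹ (inv_ne_zero hc) hinv _ hx
    simpa [mul_assoc] using this
  · intro g hg
    obtain ⟨c, hc⟩ := exists_minor_eq_mul (v := fun j => wordEval k (A' j))
      (v' := fun j => wordEval k ((g * A j * g⁻¹ : GL (Fin n) ℝ) : Matrix (Fin n) (Fin n) ℝ))
      (fun j => hspan _ ((Subgroup.mem_normalizer_iff.1 hg _).1 (hA j)))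
    have h : ∀ i : Fin (Fintype.card (WordSlot d k → Bool)),
        tensorMap _ _ (glEquiv g) (wedgeTensor (e.symm i) i A') =
          ((g : Matrix (Fin n) (Fin n) ℝ).det ^ 2 * c ^ 2) • wedgeTensor (e.symm i) i A' := by
      intro i
      simp only [Units.val_mul] at hc
      rw [tensorMap_wedgeTensor, wedgeTensor_eq_smul hc, smul_smul]
    refine ⟨_, ?_, fun h0 => absurd h0 hn.ne', h⟩
    obtain ⟨i, hi⟩ := hne
    -- The factor is a product of squares, and it is nonzero because `g` acts injectively on some
    -- nonzero component.
    refine lt_of_le_of_ne (by positivity) fun h0 => ?_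
    have := h i
    rw [← h0, zero_smul, LinearEquiv.map_eq_zero_iff] at this
    exact hi this
  · intro _ c hc
    set l : ℝ := c ^ ((2 * n : ℕ) : ℝ)⁻¹ with hl
    have hl0 : l ≠ 0 := (Real.rpow_pos_of_pos hc _).ne'
    have hlc : (l ^ n) ^ 2 = c := by
      rw [← pow_mul, mul_comm, hl]
      exact Real.rpow_inv_natCast_pow hc.le (by omega)
    refine ⟨Units.map (algebraMap ℝ (Matrix (Fin n) (Fin n) ℝ)).toMonoidHom (Units.mk0 l hl0),
      fun i => ?_⟩
    rw [tensorMap_scalar_wedgeTensor, Units.val_mk0, hlc]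

end StabilizerTensor

/-! ### Smoothness of changes of frames -/

section Smoothness

variable {n : ℕ} {M : Type*} [TopologicalSpace M] [ChartedSpace (EuclideanSpace ℝ (Fin n)) M]

theorem contMDiffAt_det {A : M → Matrix (Fin n) (Fin n) ℝ} {x : M}
    (hA : ∀ i j, ContMDiffAt (𝓡 n) 𝓘(ℝ, ℝ) ∞ (fun y => A y i j) x) :
    ContMDiffAt (𝓡 n) 𝓘(ℝ, ℝ) ∞ (fun y => (A y).det) x := by
  simp only [Matrix.det_apply']
  exact contMDiffAt_finsetSum fun σ _ =>
    contMDiffAt_const.mul (contMDiffAt_finsetProd fun i _ => hA _ _)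

theorem exists_glEquiv_eq (α : (Fin n → ℝ) ≃ₗ[ℝ] (Fin n → ℝ)) :
    ∃ g : GL (Fin n) ℝ, glEquiv g = α := by
  have h1 : LinearMap.toMatrix' α.toLinearMap * LinearMap.toMatrix' α.symm.toLinearMap = 1 := by
    rw [← LinearMap.toMatrix'_comp]
    simp
  have h2 : LinearMap.toMatrix' α.symm.toLinearMap * LinearMap.toMatrix' α.toLinearMap = 1 := by
    rw [← LinearMap.toMatrix'_comp]
    simp
  refine ⟨⟨_, _, h1, h2⟩, ?_⟩
  ext1 v
  rw [glEquiv_apply, ← Matrix.toLin'_apply, Matrix.toLin'_toMatrix']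
  rfl

theorem basis_functional_eq_sum {ι X : Type*} [Fintype ι] [AddCommMonoid X] [Module ℝ X]
    (b : Module.Basis ι ℝ X) (φ : X →ₗ[ℝ] ℝ) (t : X) : φ t = ∑ q, b.repr t q * φ (b q) := by
  conv_lhs => rw [← b.sum_repr t]
  simp only [map_sum, map_smul, smul_eq_mul]

theorem contMDiffAt_tensorMap {α : M → ((Fin n → ℝ) ≃ₗ[ℝ] (Fin n → ℝ))} {x : M}
    (h : ∀ i j, ContMDiffAt (𝓡 n) 𝓘(ℝ, ℝ) ∞ (fun y => α y (Pi.single j 1) i) x)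
    (h' : ∀ i j, ContMDiffAt (𝓡 n) 𝓘(ℝ, ℝ) ∞ (fun y => (α y).symm (Pi.single j 1) i) x)
    {r s : ℕ} (t : TensorOfType r s (Fin n → ℝ)) (φ : TensorOfType r s (Fin n → ℝ) →ₗ[ℝ] ℝ) :
    ContMDiffAt (𝓡 n) 𝓘(ℝ, ℝ) ∞ (fun y => φ (tensorMap r s (α y) t)) x := by
  choose g hg using fun y => exists_glEquiv_eq (α y)
  have hg₁ : ∀ y i j, (g y : Matrix (Fin n) (Fin n) ℝ) i j = α y (Pi.single j 1) i := by
    intro y i j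
    simp [← hg, glEquiv_apply]
  have hg₂ : ∀ y i j, ((g y)⁻¹.1 : Matrix (Fin n) (Fin n) ℝ) i j =
      (α y).symm (Pi.single j 1) i := by
    intro y i j
    simp only [← hg, glEquiv_symm_apply]
    simp
  have h₁ : ∀ y, φ (tensorMap r s (α y) t) =
      ∑ q, (tensorBasis n r s).repr (tensorMap r s (glEquiv (g y)) t) q * φ (tensorBasis n r s q) :=
    fun y => by rw [hg]; exact basis_functional_eq_sum _ _ _
  simp only [h₁, tensorBasis_repr_tensorMap, hg₁, hg₂]
  refine contMDiffAt_finsetSum fun q _ => ContMDiffAt.mul ?_ contMDiffAt_const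
  refine contMDiffAt_finsetSum fun p _ => ContMDiffAt.mul (ContMDiffAt.mul ?_ ?_) contMDiffAt_const
  · exact contMDiffAt_finsetProd fun a _ => h _ _
  · exact contMDiffAt_finsetProd fun a _ => h' _ _

variable [IsManifold (𝓡 n) ∞ M]

/-- The matrix of a frame at `y` in the trivialization of the tangent bundle around `x`. -/
def frameMatrix (x : M) (σ : ∀ y : M, LinearFrame n y) (y : M) : Matrix (Fin n) (Fin n) ℝ :=
  Matrix.of fun i j => (trivializationAt (EuclideanSpace ℝ (Fin n)) (TangentSpace (𝓡 n)) x
    (⟨y, σ y (Pi.single j 1)⟩ : TangentBundle (𝓡 n) M)).2 i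

theorem contMDiffAt_frameMatrix {σ : ∀ y : M, LinearFrame n y} {U : Set M} (hU : IsOpen U)
    (hσ : IsSmoothFrameOn σ U) {x : M} (hx : x ∈ U) (i j : Fin n) :
    ContMDiffAt (𝓡 n) 𝓘(ℝ, ℝ) ∞ (fun y => frameMatrix x σ y i j) x := by
  have h := (Bundle.contMDiffAt_section x).1 ((hσ j).contMDiffAt (hU.mem_nhds hx))
  have h1 : ContMDiffAt 𝓘(ℝ, EuclideanSpace ℝ (Fin n)) 𝓘(ℝ, ℝ) ∞
      (EuclideanSpace.proj (𝕜 := ℝ) i)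
      (trivializationAt (EuclideanSpace ℝ (Fin n)) (TangentSpace (𝓡 n)) x
        (⟨x, σ x (Pi.single j 1)⟩ : TangentBundle (𝓡 n) M)).2 :=
    (EuclideanSpace.proj (𝕜 := ℝ) i).contDiff.contMDiff.contMDiffAt
  exact h1.comp x h

/-- A frame at `y` read in the trivialization of the tangent bundle around `x`. -/
def frameEquiv (x : M) {y : M}
    (hy : y ∈ (trivializationAt (EuclideanSpace ℝ (Fin n)) (TangentSpace (𝓡 n)) x).baseSet)
    (z : LinearFrame n y) : (Fin n → ℝ) ≃ₗ[ℝ] (Fin n → ℝ) :=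
  (z.trans ((trivializationAt (EuclideanSpace ℝ (Fin n))
    (TangentSpace (𝓡 n)) x).linearEquivAt ℝ y hy)).trans (WithLp.linearEquiv 2 ℝ (Fin n → ℝ))

theorem frameMatrix_eq_toMatrix' (x : M) {y : M}
    (hy : y ∈ (trivializationAt (EuclideanSpace ℝ (Fin n)) (TangentSpace (𝓡 n)) x).baseSet)
    (σ : ∀ y : M, LinearFrame n y) :
    frameMatrix x σ y = LinearMap.toMatrix' (frameEquiv x hy (σ y)).toLinearMap := by
  ext i j
  rw [LinearMap.toMatrix'_apply]
  rfl

/-- In a trivialization around `x` the coordinates of one frame in another solve a linear system;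
Cramer's rule writes them as quotients of smooth determinants. -/
theorem contMDiffAt_frame_change {σ σ' : ∀ y : M, LinearFrame n y} {U U' : Set M} (hU : IsOpen U)
    (hU' : IsOpen U') (hσ : IsSmoothFrameOn σ U) (hσ' : IsSmoothFrameOn σ' U') {x : M}
    (hx : x ∈ U) (hx' : x ∈ U') (i j : Fin n) :
    ContMDiffAt (𝓡 n) 𝓘(ℝ, ℝ) ∞ (fun y => (σ y).symm (σ' y (Pi.single j 1)) i) x := by
  set e := trivializationAt (EuclideanSpace ℝ (Fin n)) (TangentSpace (𝓡 n)) x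
  have hxe : x ∈ e.baseSet := FiberBundle.mem_baseSet_trivializationAt' x
  have hdet : ∀ y ∈ e.baseSet, (frameMatrix x σ y).det ≠ 0 := by
    intro y hy
    rw [frameMatrix_eq_toMatrix' x hy, LinearMap.det_toMatrix']
    exact (LinearEquiv.isUnit_det' _).ne_zero
  have hcramer : ∀ y ∈ e.baseSet,
      ((frameMatrix x σ y).updateCol i fun l => frameMatrix x σ' y l j).det /
        (frameMatrix x σ y).det = (σ y).symm (σ' y (Pi.single j 1)) i := by
    intro y hy
    rw [div_eq_iff (hdet y hy), ← Matrix.cramer_apply]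
    have h1 : (fun l => frameMatrix x σ' y l j) =
        (frameMatrix x σ y).mulVec ((σ y).symm (σ' y (Pi.single j 1))) := by
      rw [frameMatrix_eq_toMatrix' x hy σ, ← Matrix.toLin'_apply, Matrix.toLin'_toMatrix']
      simp only [frameEquiv, LinearEquiv.coe_coe, LinearEquiv.trans_apply,
        LinearEquiv.apply_symm_apply]
      rfl
    rw [h1, Matrix.cramer_eq_adjugate_mulVec, Matrix.mulVec_mulVec, Matrix.adjugate_mul,
      Matrix.smul_mulVec, Matrix.one_mulVec, Pi.smul_apply, smul_eq_mul, mul_comm]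
  refine ContMDiffAt.congr_of_eventuallyEq ?_
    (Filter.eventuallyEq_of_mem (e.open_baseSet.mem_nhds hxe) fun y hy => (hcramer y hy).symm)
  refine ContMDiffAt.div₀ (contMDiffAt_det fun k l => ?_)
    (contMDiffAt_det fun k l => contMDiffAt_frameMatrix hU hσ hx k l) (hdet x hxe)
  by_cases hl : l = i
  · subst hl
    simpa using contMDiffAt_frameMatrix hU' hσ' hx' k j
  · simpa [hl] using contMDiffAt_frameMatrix hU hσ hx k l

theorem tensorMap_symm (r s : ℕ) {V W : Type*} [AddCommGroup V] [Module ℝ V] [AddCommGroup W]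
    [Module ℝ W] (α : V ≃ₗ[ℝ] W) : (tensorMap r s α).symm = tensorMap r s α.symm := by
  ext1 t
  rw [LinearEquiv.symm_apply_eq, ← tensorMap_trans_apply, LinearEquiv.symm_trans_self,
    tensorMap_refl, LinearEquiv.refl_apply]

theorem contMDiffAt_tensorMap_frame {σ σ' : ∀ y : M, LinearFrame n y} {U U' : Set M}
    (hU : IsOpen U) (hU' : IsOpen U') (hσ : IsSmoothFrameOn σ U) (hσ' : IsSmoothFrameOn σ' U')
    {x : M} (hx : x ∈ U) (hx' : x ∈ U') {r s : ℕ} (t : TensorOfType r s (Fin n → ℝ))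
    (φ : TensorOfType r s (Fin n → ℝ) →ₗ[ℝ] ℝ) :
    ContMDiffAt (𝓡 n) 𝓘(ℝ, ℝ) ∞
      (fun y => φ ((tensorMap r s (σ y)).symm (tensorMap r s (σ' y) t))) x := by
  simp only [tensorMap_symm, ← tensorMap_trans_apply]
  exact contMDiffAt_tensorMap (α := fun y => (σ' y).trans (σ y).symm)
    (contMDiffAt_frame_change hU hU' hσ hσ' hx hx')
    (contMDiffAt_frame_change hU' hU hσ' hσ hx' hx) t φ

end Smoothness

/-! ### The tensor fields of a structure -/

section Fields

variable {n : ℕ} {H : Subgroup (GL (Fin n) ℝ)} {m : ℕ} {r s : Fin m → ℕ}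
  {u : ∀ i, TensorOfType (r i) (s i) (Fin n → ℝ)}
  {M : Type*} [TopologicalSpace M] [ChartedSpace (EuclideanSpace ℝ (Fin n)) M]
  [IsManifold (𝓡 n) ∞ M]

theorem HStructure.frames_nonempty (P : HStructure H M) (x : M) : ∃ z, z ∈ P.frames x := by
  obtain ⟨U, -, hx, σ, -, hσ⟩ := P.exists_section x
  exact ⟨σ x, hσ x hx⟩

theorem IsStabilizerTensor.exists_pos_of_mem_frames (hu : IsStabilizerTensor H u)
    (P : HStructure H M) {x : M} {z w : LinearFrame n x} (hz : z ∈ P.frames x)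
    (hw : w ∈ P.frames x) :
    ∃ c : ℝ, 0 < c ∧ (n = 0 → c = 1) ∧
      ∀ i, tensorMap (r i) (s i) w (u i) = c • tensorMap (r i) (s i) z (u i) := by
  obtain ⟨g, hg, rfl⟩ := (P.mem_iff x z w hz).1 hw
  obtain ⟨c, hc, hc1, h⟩ := hu.exists_pos g hg
  refine ⟨c, hc, hc1, fun i => ?_⟩
  rw [tensorMap_trans_apply, h, LinearEquiv.map_smul]

theorem IsStabilizerTensor.mem_frames_of_eq_smul (hu : IsStabilizerTensor H u)
    (P : HStructure H M) {x : M} {z w : LinearFrame n x} (hz : z ∈ P.frames x) {c : ℝ}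
    (hc : c ≠ 0)
    (h : ∀ i, tensorMap (r i) (s i) w (u i) = c • tensorMap (r i) (s i) z (u i)) :
    w ∈ P.frames x := by
  obtain ⟨g, hg⟩ := exists_glEquiv_eq (w.trans z.symm)
  refine (P.mem_iff x z w hz).2 ⟨g, hu.mem_of_eq_smul g c hc fun i => ?_, ?_⟩
  · rw [hg, tensorMap_trans_apply, h, LinearEquiv.map_smul, tensorMap_symm_apply_self]
  · rw [hg, LinearEquiv.trans_assoc, LinearEquiv.symm_trans_self, LinearEquiv.trans_refl]

/-- The fields `σ a y ↦ u i` are averaged by a partition of unity. Positivity of the character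
prevents cancellation, and the same weights serve all `i`, so the factor is common. -/
theorem IsStabilizerTensor.exists_smooth_fields [T2Space M] [SecondCountableTopology M]
    (hu : IsStabilizerTensor H u) (P : HStructure H M) :
    ∃ t : ∀ (i : Fin m) (x : M), TensorOfType (r i) (s i) (TangentSpace (𝓡 n) x),
      (∀ i, IsSmoothTensorField (t i)) ∧
      ∀ (x : M) (z : LinearFrame n x), z ∈ P.frames x → ∃ c : ℝ, 0 < c ∧ (n = 0 → c = 1) ∧
        ∀ i, t i x = c • tensorMap (r i) (s i) z (u i) := by
  choose U hU hxU σ hσ hσP using P.exists_section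
  have : LocallyCompactSpace M := ChartedSpace.locallyCompactSpace (EuclideanSpace ℝ (Fin n)) M
  obtain ⟨ψ, hψ⟩ := SmoothPartitionOfUnity.exists_isSubordinate (𝓡 n) isClosed_univ U hU
    fun x _ => Set.mem_iUnion.2 ⟨x, hxU x⟩
  have hmem : ∀ (a y : M), ψ a y ≠ 0 → y ∈ U a := fun a y h => hψ a (subset_tsupport _ h)
  refine ⟨fun i y => ∑ a ∈ ψ.finsupport y, ψ a y • tensorMap (r i) (s i) (σ a y) (u i),
    fun i x => ⟨U x, hU x, hxU x, σ x, hσ x, fun φ y hy => ?_⟩, fun x z hz => ?_⟩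
  · have h1 : ∀ y, φ ((tensorMap (r i) (s i) (σ x y)).symm
        (∑ a ∈ ψ.finsupport y, ψ a y • tensorMap (r i) (s i) (σ a y) (u i))) =
        ∑ᶠ a, ψ a y • φ ((tensorMap (r i) (s i) (σ x y)).symm
          (tensorMap (r i) (s i) (σ a y) (u i))) := by
      intro y
      rw [← ψ.sum_finsupport_smul_eq_finsum y (fun a y => φ ((tensorMap (r i) (s i) (σ x y)).symm
        (tensorMap (r i) (s i) (σ a y) (u i))))]
      refine (map_sum (φ ∘ₗ (tensorMap (r i) (s i) (σ x y)).symm.toLinearMap) _ _).trans ?_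
      exact Finset.sum_congr rfl fun a _ => map_smul (φ ∘ₗ _) _ _
    simp only [h1]
    refine (ψ.contMDiffAt_finsum fun a ha => ?_).contMDiffWithinAt
    exact contMDiffAt_tensorMap_frame (hU x) (hU a) (hσ x) (hσ a) hy (hψ a ha) _ _
  · have h1 : ∀ a, ∃ c : ℝ, 0 < c ∧ (n = 0 → c = 1) ∧ (x ∈ U a →
        ∀ i, tensorMap (r i) (s i) (σ a x) (u i) = c • tensorMap (r i) (s i) z (u i)) := by
      intro a
      by_cases hx : x ∈ U a
      · obtain ⟨c, hc, hc1, h⟩ := hu.exists_pos_of_mem_frames P hz (hσP a x hx)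
        exact ⟨c, hc, hc1, fun _ => h⟩
      -- Outside `U a` the weight `ψ a x` vanishes; `1` is a harmless positive default.
      · exact ⟨1, one_pos, fun _ => rfl, fun h => absurd h hx⟩
    choose κ hκ hκ1 hκσ using h1
    have hsum := ψ.sum_finsupport x (Set.mem_univ x)
    refine ⟨∑ a ∈ ψ.finsupport x, ψ a x * κ a, ?_, fun h0 => ?_, fun i => ?_⟩
    · refine Finset.sum_pos (fun a ha => mul_pos ?_ (hκ a)) ?_
      · exact lt_of_le_of_ne (ψ.nonneg a x) (Ne.symm ((ψ.mem_finsupport x).1 ha))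
      · by_contra he
        rw [Finset.not_nonempty_iff_eq_empty] at he
        simp [he] at hsum
    · simp only [hκ1 _ h0, mul_one, hsum]
    · rw [Finset.sum_smul]
      refine Finset.sum_congr rfl fun a ha => ?_
      rw [hκσ a (hmem a x ((ψ.mem_finsupport x).1 ha)), smul_smul]

theorem IsStabilizerTensor.isZeroDeformable (hu : IsStabilizerTensor H u)
    (P : HStructure H M)
    {t : ∀ (i : Fin m) (x : M), TensorOfType (r i) (s i) (TangentSpace (𝓡 n) x)}
    (ht : ∀ (x : M) (z : LinearFrame n x), z ∈ P.frames x → ∃ c : ℝ, 0 < c ∧ (n = 0 → c = 1) ∧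
      ∀ i, t i x = c • tensorMap (r i) (s i) z (u i)) (i : Fin m) :
    IsZeroDeformable (t i) := by
  intro x y
  obtain ⟨z, hz⟩ := P.frames_nonempty x
  obtain ⟨w, hw⟩ := P.frames_nonempty y
  obtain ⟨a, ha, ha1, hta⟩ := ht x z hz
  obtain ⟨b, hb, hb1, htb⟩ := ht y w hw
  obtain ⟨g, hg⟩ : ∃ g : GL (Fin n) ℝ, ∀ i,
      tensorMap (r i) (s i) (glEquiv g) (u i) = (b / a) • u i := by
    by_cases h0 : n = 0
    · obtain ⟨c, -, hc1, h⟩ := hu.exists_pos 1 H.one_mem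
      refine ⟨1, fun i => ?_⟩
      rw [h, hc1 h0, ha1 h0, hb1 h0, div_one]
    · exact hu.exists_scaling h0 _ (div_pos hb ha)
  -- The frames carry `a • u i` to `b • u i` through `ℝⁿ`, with `g` supplying the factor `b / a`.
  refine ⟨(z.symm.trans (glEquiv g)).trans w, ?_⟩
  rw [hta, htb, tensorMap_trans_apply, tensorMap_trans_apply, LinearEquiv.map_smul,
    tensorMap_symm_apply_self, LinearEquiv.map_smul, hg, smul_smul, mul_div_cancel₀ _ ha.ne',
    LinearEquiv.map_smul]

end Fields

end

theorem mainTheorem12 {n : ℕ} (G : Subgroup (GL (Fin n) ℝ)) (hG : IsAlgebraicSubgroup G) :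
    ∃ (m : ℕ) (r s : Fin m → ℕ) (u : ∀ i, TensorOfType (r i) (s i) (Fin n → ℝ))
      (hu : tensorSum u ≠ 0),
      Function.Injective (fun i => (r i, s i)) ∧
      (∀ g : GL (Fin n) ℝ, g ∈ Subgroup.normalizer (G : Set (GL (Fin n) ℝ)) ↔
        projTensorMap (glEquiv g) (Projectivization.mk ℝ (tensorSum u) hu) =
          Projectivization.mk ℝ (tensorSum u) hu) ∧
      ∀ (M : Type*) [TopologicalSpace M] [T2Space M] [SecondCountableTopology M]
        [ChartedSpace (EuclideanSpace ℝ (Fin n)) M] [IsManifold (𝓡 n) ∞ M]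
        (P : HStructure (Subgroup.normalizer (G : Set (GL (Fin n) ℝ))) M),
        ∃ (t : ∀ (i : Fin m) (x : M), TensorOfType (r i) (s i) (TangentSpace (𝓡 n) x))
          (ht : ∀ x : M, tensorSum (fun i => t i x) ≠ 0),
          (∀ i, IsSmoothTensorField (t i)) ∧
          (∀ i, IsZeroDeformable (t i)) ∧
          ∀ (x : M) (z : LinearFrame n x),
            z ∈ P.frames x ↔
              projTensorMap z (Projectivization.mk ℝ (tensorSum u) hu) =
                Projectivization.mk ℝ (tensorSum (fun i => t i x)) (ht x) := by
  obtain ⟨m, r, s, u, hu⟩ := exists_isStabilizerTensor_normalizer hG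
  refine ⟨m, r, s, u, hu.tensorSum_ne_zero, hu.injective, fun g => ?_, ?_⟩
  · rw [projTensorMap_mk_eq_iff hu.injective]
    constructor
    · intro hg
      obtain ⟨c, hc, -, h⟩ := hu.exists_pos g hg
      exact ⟨c, hc.ne', h⟩
    · rintro ⟨c, hc, h⟩
      exact hu.mem_of_eq_smul g c hc h
  intro M _ _ _ _ _ P
  obtain ⟨t, ht, htz⟩ := hu.exists_smooth_fields P
  have hne : ∀ x : M, tensorSum (fun i => t i x) ≠ 0 := by
    intro x h
    obtain ⟨z, hz⟩ := P.frames_nonempty x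
    obtain ⟨c, hc, -, htc⟩ := htz x z hz
    obtain ⟨i, hi⟩ := hu.exists_ne_zero
    have h1 := tensorSum_component hu.injective (fun i => t i x) i
    rw [h, htc] at h1
    have h2 : tensorMap (r i) (s i) z (u i) = 0 := by
      rw [← inv_smul_smul₀ hc.ne' (tensorMap (r i) (s i) z (u i)), ← h1]
      exact smul_zero _
    exact hi ((tensorMap (r i) (s i) z).map_eq_zero_iff.1 h2)
  refine ⟨t, hne, ht, hu.isZeroDeformable P htz, fun x z => ?_⟩
  rw [projTensorMap_mk_eq_iff hu.injective]
  constructor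
  · intro hz
    obtain ⟨c, hc, -, htc⟩ := htz x z hz
    refine ⟨c⁻¹, inv_ne_zero hc.ne', fun i => ?_⟩
    rw [htc, inv_smul_smul₀ hc.ne']
  · rintro ⟨c, hc, h⟩
    -- Comparison with one frame `w` of the structure reduces membership of `z` to the stabilizer
    -- property.
    obtain ⟨w, hw⟩ := P.frames_nonempty x
    obtain ⟨a, ha, -, hta⟩ := htz x w hw
    refine hu.mem_frames_of_eq_smul P hw (mul_ne_zero hc ha.ne') fun i => ?_
    rw [h, hta, smul_smul]
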